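/- All graphs are finite, simple and undirected. For a graph $G$, let $q(G)$ denote its signless Laplacian spectral radius, i.e. the largest eigenvalue of $Q(G)=D(G)+A(G)$, where $A(G)$ is the adjacency matrix and $D(G)$ the diagonal degree matrix of $G$. Let $c(G-S)$ be the number of connected components of the subgraph induced by $V(G)\setminus S$, and let $\alpha(G)$ be the independence number. For an integer $l\ge 2$, the $l$-toughness of $G$ is $$t_l(G)=\min\left\{\frac{|S|}{c(G-S)} : S\subseteq V(G),\ c(G-S)\ge l\right\}\quad\text{if } l\le\alpha(G),\qquad t_l(G)=+\infty\quad\text{if } l>\alpha(G).$$ Write $G_1\cup G_2$ for the disjoint union, $tK_1$ for the graph with $t$ vertices and no edges, and $G_1\vee G_2$ for the join (the disjoint union together with all edges between $V(G_1)$ and $V(G_2)$). **Theorem 1.1.** Let $b\ge1$ and $l\ge2$ be integers, and let $G$ be a connected graph of order $n$ with $$n\ge\max\left\{\left(\tfrac52b^2+4b+3\right)l-b^2-2b-5,\ \tfrac{(2b+1)l^2+(2b-3)l+2}{2}\right\}.$$ Put $H=K_{bl-1}\vee(K_{n-(b+1)l+2}\cup(l-1)K_1)$. If $q(G)\ge q(H)$,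 then $t_l(G)\ge b$ unless $G$ is isomorphic to $H$; and if $G$ is isomorphic to $H$, then $t_l(G)<b$. -/

import Mathlib

open scoped ENNReal

open Classical in
/-- The signless Laplacian matrix `Q(G) = D(G) + A(G)`. -/
noncomputable def signlessLaplacian {V : Type*} [Fintype V] (G : SimpleGraph V) :
    Matrix V V ℝ :=
  G.degMatrix ℝ + G.adjMatrix ℝ

/-- The signless Laplacian spectral radius (`Q`-index) `q(G)`: the largest eigenvalue of `Q(G)`.
The set of eigenvalues is finite, and nonempty when `V` is (the matrix is real symmetric), so the
supremum is a maximum. -/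
noncomputable def qIndex {V : Type*} [Fintype V] (G : SimpleGraph V) : ℝ :=
  sSup {μ : ℝ | ∃ x : V → ℝ, x ≠ 0 ∧ (signlessLaplacian G).mulVec x = μ • x}

/-- `c(G - S)`: the number of connected components of the subgraph induced by `V(G) \ S`. -/
noncomputable def numComponentsDelete {V : Type*} (G : SimpleGraph V) (S : Finset V) : ℕ :=
  Nat.card (G.induce {v : V | v ∉ S}).ConnectedComponent

open Classical in
/-- The `l`-toughness (for `l ≥ 2`): the minimum of `|S| / c(G - S)` over the vertex sets `S` with
`c(G - S) ≥ l` if `l ≤ α(G)`, and `+∞` if `l > α(G)`. There are finitely many `S`, and at least one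
admissible `S` if `l ≤ α(G)`, so that the infimum is a minimum. -/
noncomputable def lToughness {V : Type*} [Fintype V] (l : ℕ) (G : SimpleGraph V) : ℝ≥0∞ :=
  if l ≤ G.indepNum then
    ⨅ (S : Finset V) (_ : l ≤ numComponentsDelete G S),
      (S.card : ℝ≥0∞) / (numComponentsDelete G S : ℝ≥0∞)
  else ⊤

/-- The join `G ∨ H`: the disjoint union of `G` and `H` together with all edges between them. -/
def graphJoin {V W : Type*} (G : SimpleGraph V) (H : SimpleGraph W) : SimpleGraph (V ⊕ W) :=
  (G ⊕g H) ⊔ completeBipartiteGraph V W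

/-- The graph `K_{bl-1} ∨ (K_{n-(b+1)l+2} ∪ (l-1) K_1)`. The natural number subtractions are the
true ones when `1 ≤ b`, `2 ≤ l` and `(b+1)l ≤ n + 2`; the graph then has order `n`. -/
def extremalGraph (b l n : ℕ) :
    SimpleGraph (Fin (b * l - 1) ⊕ (Fin (n + 2 - (b + 1) * l) ⊕ Fin (l - 1))) :=
  graphJoin (⊤ : SimpleGraph (Fin (b * l - 1)))
    ((⊤ : SimpleGraph (Fin (n + 2 - (b + 1) * l))) ⊕g (⊥ : SimpleGraph (Fin (l - 1))))

/-! If `t_l(G) < b`, some `S` leaves `c ≥ l` components with `|S| ≤ bc - 1`. Since `H` contains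
`K_{n-l+1}` and further edges at it, `q(H) > 2n - 2l`, and the Feng–Yu bound
(`qIndex_le_of_connected`) turns `q(G) ≥ q(H)` into a degree sum above `(n-1)(n-2l+2)`.

A graph split by `S` into `c` pieces misses every pair between pieces (`sum_adj_add_le_of_label`).
Convexity of the sum of squared piece sizes, with the bounds on `n`, then rules out `c > l`, and
also `c = l` with two components of order at least 2. In the remaining case `G` is a spanning
subgraph of `H`, so Perron–Frobenius gives `q(G) < q(H)` unless `G ≅ H` (`qIndex_lt_of_equiv`).
Conversely, deleting the `bl - 1` join vertices of `H` leaves `l` components. -/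

section SignlessLaplacian

/-! ### Spectral theory of the signless Laplacian. -/

variable {V : Type*} [Fintype V]

open Classical in
theorem signlessLaplacian_mulVec_apply (G : SimpleGraph V) (x : V → ℝ) (u : V) :
    (signlessLaplacian G).mulVec x u = ∑ v, if G.Adj u v then x u + x v else 0 := by
  rw [signlessLaplacian, Matrix.add_mulVec, Pi.add_apply, SimpleGraph.adjMatrix_mulVec_apply,
    SimpleGraph.degMatrix, Matrix.mulVec_diagonal, ← Finset.sum_filter, Finset.sum_add_distrib,
    Finset.sum_const, nsmul_eq_mul, ← SimpleGraph.card_neighborFinset_eq_degree,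
    SimpleGraph.neighborFinset_eq_filter]

open Classical in
theorem dotProduct_signlessLaplacian_mulVec (G : SimpleGraph V) (x : V → ℝ) :
    x ⬝ᵥ (signlessLaplacian G).mulVec x =
      (∑ u, ∑ v, if G.Adj u v then (x u + x v) ^ 2 else 0) / 2 := by
  have h1 : x ⬝ᵥ (signlessLaplacian G).mulVec x =
      ∑ u, ∑ v, if G.Adj u v then x u * (x u + x v) else 0 := by
    simp only [dotProduct, signlessLaplacian_mulVec_apply, Finset.mul_sum, mul_ite, mul_zero]
  have h2 : x ⬝ᵥ (signlessLaplacian G).mulVec x =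
      ∑ u, ∑ v, if G.Adj u v then x v * (x u + x v) else 0 := by
    rw [h1, Finset.sum_comm]
    refine Finset.sum_congr rfl fun u _ => Finset.sum_congr rfl fun v _ => ?_
    rw [SimpleGraph.adj_comm, add_comm]
  rw [eq_div_iff two_ne_zero, mul_two]
  nth_rewrite 1 [h1]
  rw [h2]
  simp only [← Finset.sum_add_distrib]
  refine Finset.sum_congr rfl fun u _ => Finset.sum_congr rfl fun v _ => ?_
  split_ifs <;> ring

theorem signlessLaplacian_isHermitian (G : SimpleGraph V) : (signlessLaplacian G).IsHermitian := by
  classical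
  ext u v
  by_cases h : u = v
  · subst h; simp
  · simp [signlessLaplacian, SimpleGraph.degMatrix, SimpleGraph.adj_comm,
      h, Ne.symm h]

theorem finite_signlessLaplacian_eigenvalues (G : SimpleGraph V) :
    {μ : ℝ | ∃ x : V → ℝ, x ≠ 0 ∧ (signlessLaplacian G).mulVec x = μ • x}.Finite := by
  classical
  refine (Module.End.finite_hasEigenvalue (Matrix.toLin' (signlessLaplacian G))).subset ?_
  rintro μ ⟨x, hx, h⟩
  exact Module.End.hasEigenvalue_of_hasEigenvector (x := x)
    (Module.End.hasEigenvector_iff.2 ⟨Module.End.mem_eigenspace_iff.2 (by simpa using h), hx⟩)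

theorem le_qIndex (G : SimpleGraph V) {μ : ℝ} {x : V → ℝ} (hx : x ≠ 0)
    (h : (signlessLaplacian G).mulVec x = μ • x) : μ ≤ qIndex G :=
  le_csSup (finite_signlessLaplacian_eigenvalues G).bddAbove ⟨x, hx, h⟩

theorem exists_mulVec_eq_qIndex [Nonempty V] (G : SimpleGraph V) :
    ∃ x : V → ℝ, x ≠ 0 ∧ (signlessLaplacian G).mulVec x = qIndex G • x := by
  classical
  refine Set.Nonempty.csSup_mem ?_ (finite_signlessLaplacian_eigenvalues G)
  have hM := signlessLaplacian_isHermitian G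
  obtain ⟨i⟩ := ‹Nonempty V›
  refine ⟨hM.eigenvalues i, (hM.eigenvectorBasis i).ofLp, ?_, hM.mulVec_eigenvectorBasis i⟩
  intro h
  exact hM.eigenvectorBasis.orthonormal.ne_zero i (by ext j; exact congrFun h j)

open Classical in
theorem posSemidef_qIndex_sub (G : SimpleGraph V) :
    (qIndex G • (1 : Matrix V V ℝ) - signlessLaplacian G).PosSemidef := by
  have hM : (qIndex G • (1 : Matrix V V ℝ) - signlessLaplacian G).IsHermitian :=
    (Matrix.isHermitian_one.smul (by simp [IsSelfAdjoint])).sub (signlessLaplacian_isHermitian G)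
  refine hM.posSemidef_iff_eigenvalues_nonneg.2 fun i => ?_
  have h := hM.mulVec_eigenvectorBasis i
  have h0 : (hM.eigenvectorBasis i).ofLp ≠ 0 := fun h =>
    hM.eigenvectorBasis.orthonormal.ne_zero i (by ext j; exact congrFun h j)
  have := le_qIndex G (μ := qIndex G - hM.eigenvalues i) h0 (by
    rw [Matrix.sub_mulVec, Matrix.smul_mulVec, Matrix.one_mulVec] at h
    rw [sub_smul, ← h]; simp)
  simpa using this

theorem dotProduct_signlessLaplacian_mulVec_le (G : SimpleGraph V) (x : V → ℝ) :
    x ⬝ᵥ (signlessLaplacian G).mulVec x ≤ qIndex G * (x ⬝ᵥ x) := by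
  classical
  have h := (posSemidef_qIndex_sub G).dotProduct_mulVec_nonneg x
  rw [Matrix.sub_mulVec, Matrix.smul_mulVec, Matrix.one_mulVec, dotProduct_sub,
    dotProduct_smul] at h
  simpa using h

theorem mulVec_eq_qIndex_smul_of_le (G : SimpleGraph V) (x : V → ℝ)
    (hx : qIndex G * (x ⬝ᵥ x) ≤ x ⬝ᵥ (signlessLaplacian G).mulVec x) :
    (signlessLaplacian G).mulVec x = qIndex G • x := by
  classical
  have h := ((posSemidef_qIndex_sub G).dotProduct_mulVec_zero_iff x).1 (by
    rw [Matrix.sub_mulVec, Matrix.smul_mulVec, Matrix.one_mulVec, dotProduct_sub,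
      dotProduct_smul]
    have := dotProduct_signlessLaplacian_mulVec_le G x
    simp only [star_trivial, smul_eq_mul]
    linarith)
  rw [Matrix.sub_mulVec, Matrix.smul_mulVec, Matrix.one_mulVec, sub_eq_zero] at h
  exact h.symm

/-- Perron–Frobenius: replacing a top eigenvector by its absolute value does not decrease the
quadratic form, so it is again an eigenvector; a zero entry would spread along edges to all of `G`.
-/
theorem exists_pos_mulVec_eq_qIndex (G : SimpleGraph V) (hG : G.Connected) :
    ∃ x : V → ℝ, (∀ v, 0 < x v) ∧ (signlessLaplacian G).mulVec x = qIndex G • x := by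
  classical
  have := hG.nonempty
  obtain ⟨x, hx, hxe⟩ := exists_mulVec_eq_qIndex G
  set y : V → ℝ := fun v => |x v| with hy
  have hye : (signlessLaplacian G).mulVec y = qIndex G • y := by
    refine mulVec_eq_qIndex_smul_of_le G y ?_
    have h1 : y ⬝ᵥ y = x ⬝ᵥ x := by simp [dotProduct, hy]
    have h2 : qIndex G * (x ⬝ᵥ x) = x ⬝ᵥ (signlessLaplacian G).mulVec x := by
      rw [hxe, dotProduct_smul, smul_eq_mul]
    rw [h1, h2, dotProduct_signlessLaplacian_mulVec, dotProduct_signlessLaplacian_mulVec]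
    gcongr with u _ v _
    split_ifs
    · exact sq_le_sq.2 (by rw [abs_of_nonneg (a := y u + y v) (by positivity)]; exact abs_add_le _ _)
    · exact le_rfl
  refine ⟨y, ?_, hye⟩
  by_contra! hcon
  obtain ⟨u, hu⟩ := hcon
  have hu0 : y u = 0 := le_antisymm hu (abs_nonneg _)
  have step : ∀ a b, G.Adj a b → y a = 0 → y b = 0 := by
    intro a b hab ha
    have h := congrFun hye a
    rw [signlessLaplacian_mulVec_apply, Pi.smul_apply, ha, smul_zero,
      Finset.sum_eq_zero_iff_of_nonneg (fun v _ => by split_ifs <;> positivity)] at h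
    simpa [hab] using h b (Finset.mem_univ b)
  have all : ∀ v, y v = 0 := by
    intro v
    obtain ⟨p⟩ := hG.preconnected u v
    induction p with
    | nil => exact hu0
    | cons hab _ ih => exact ih (step _ _ hab hu0).le (step _ _ hab hu0)
  exact hx (funext fun v => abs_eq_zero.1 (all v))

/-- Strict monotonicity of the `Q`-index under the addition of edges to a connected graph. -/
theorem qIndex_lt_of_equiv {W : Type*} [Fintype W] (G : SimpleGraph V) (H : SimpleGraph W)
    (hG : G.Connected) (g : W ≃ V) (hg : ∀ x y, G.Adj (g x) (g y) → H.Adj x y)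
    (hne : ¬ Nonempty (G ≃g H)) : qIndex G < qIndex H := by
  classical
  obtain ⟨x, hx, hxe⟩ := exists_pos_mulVec_eq_qIndex G hG
  obtain ⟨a, b, hab, hnab⟩ : ∃ a b, H.Adj a b ∧ ¬ G.Adj (g a) (g b) := by
    by_contra! hcon
    exact hne ⟨(SimpleGraph.Iso.symm ⟨g, fun {a b} => ⟨hg a b, hcon a b⟩⟩)⟩
  have h1 : (x ∘ g) ⬝ᵥ (x ∘ g) = x ⬝ᵥ x := Equiv.sum_comp g fun v => x v * x v
  have h2 : x ⬝ᵥ (signlessLaplacian G).mulVec x <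
      (x ∘ g) ⬝ᵥ (signlessLaplacian H).mulVec (x ∘ g) := by
    rw [dotProduct_signlessLaplacian_mulVec, dotProduct_signlessLaplacian_mulVec,
      ← Equiv.sum_comp g]
    simp_rw [← Equiv.sum_comp g (fun v => if G.Adj _ v then _ else _)]
    have key : ∀ u v, (if G.Adj (g u) (g v) then (x (g u) + x (g v)) ^ 2 else 0) ≤
        if H.Adj u v then ((x ∘ g) u + (x ∘ g) v) ^ 2 else 0 := by
      intro u v
      by_cases h : G.Adj (g u) (g v)
      · simp [h, hg u v h]
      · rw [if_neg h]; split_ifs <;> positivity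
    refine div_lt_div_of_pos_right ?_ two_pos
    refine Finset.sum_lt_sum (fun u _ => Finset.sum_le_sum fun v _ => key u v)
      ⟨a, Finset.mem_univ _, Finset.sum_lt_sum (fun v _ => key a v) ⟨b, Finset.mem_univ _, ?_⟩⟩
    rw [if_neg hnab, if_pos hab]
    have := hx (g a)
    have := hx (g b)
    simp only [Function.comp]
    positivity
  have h3 := dotProduct_signlessLaplacian_mulVec_le H (x ∘ g)
  rw [hxe, dotProduct_smul, smul_eq_mul] at h2
  rw [h1] at h3
  have := hG.nonempty
  have h4 : 0 < x ⬝ᵥ x :=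
    Finset.sum_pos (fun v _ => mul_pos (hx v) (hx v)) Finset.univ_nonempty
  exact lt_of_mul_lt_mul_right (h2.trans_le h3) h4.le

open Classical in
/-- The Feng–Yu bound `q(G) ≤ 2m / (n - 1) + n - 2`, with `2m` written as the number of ordered
pairs of adjacent vertices. -/
theorem qIndex_le_of_connected (G : SimpleGraph V) (hG : G.Connected)
    (hV : 2 ≤ Fintype.card V) :
    qIndex G ≤ (∑ u, ∑ v, if G.Adj u v then (1 : ℝ) else 0) / ((Fintype.card V : ℝ) - 1) +
      Fintype.card V - 2 := by
  have := hG.nonempty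
  have : Nontrivial V := Fintype.one_lt_card_iff_nontrivial.1 (by omega)
  obtain ⟨x, hx, hxe⟩ := exists_mulVec_eq_qIndex G
  set n : ℝ := (Fintype.card V : ℝ) with hn
  have hn2 : (2 : ℝ) ≤ n := by rw [hn]; exact_mod_cast hV
  set q := qIndex G
  obtain ⟨d, hd⟩ : ∃ d : V → ℝ, ∀ u, d u = ∑ v, if G.Adj u v then (1 : ℝ) else 0 := ⟨_, fun _ => rfl⟩
  simp_rw [← hd]
  have hd1 : ∀ u, 1 ≤ d u := by
    intro u
    obtain ⟨v, hv⟩ := hG.preconnected.exists_adj_of_nontrivial u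
    calc (1 : ℝ) = if G.Adj u v then 1 else 0 := by rw [if_pos hv]
      _ ≤ d u := by
        rw [hd]
        exact Finset.single_le_sum (f := fun v => if G.Adj u v then (1 : ℝ) else 0)
          (fun w _ => by positivity) (Finset.mem_univ v)
  have hdn : ∀ u, d u ≤ n - 1 := by
    intro u
    have : d u ≤ ∑ v, ((1 : ℝ) - if u = v then 1 else 0) := by
      rw [hd]
      refine Finset.sum_le_sum fun v _ => ?_
      by_cases h : u = v
      · subst h; simp
      · simp only [h, if_false]; split_ifs <;> norm_num
    simpa [Finset.sum_sub_distrib] using this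
  -- Row-sum bound for `Q` conjugated by the degree matrix: the row maximizing `|x v| / d v` gives
  -- `q ≤ d u + σ / d u`.
  obtain ⟨u, -, hu⟩ := Finset.exists_max_image Finset.univ (fun v => |x v| / d v)
    Finset.univ_nonempty
  replace hu := fun v => hu v (Finset.mem_univ v)
  have hdpos : ∀ v, 0 < d v := fun v => by linarith [hd1 v]
  set M := |x u| / d u with hM
  have hxM : ∀ v, |x v| ≤ M * d v := fun v => (div_le_iff₀ (hdpos v)).1 (hu v)
  have hxu : |x u| = M * d u := (div_mul_cancel₀ _ (hdpos u).ne').symm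
  have hMpos : 0 < M := by
    by_contra! hM0
    apply hx
    ext v
    exact abs_eq_zero.1 (le_antisymm ((hxM v).trans
      (mul_nonpos_of_nonpos_of_nonneg hM0 (hdpos v).le)) (abs_nonneg _))
  set σ : ℝ := ∑ v, if G.Adj u v then d v else 0 with hσ
  have h1 : q * d u ≤ d u * d u + σ := by
    have h := congrFun hxe u
    rw [signlessLaplacian_mulVec_apply, Pi.smul_apply, smul_eq_mul] at h
    have h2 : q * |x u| ≤ ∑ v, if G.Adj u v then M * d u + M * d v else 0 := by
      calc q * |x u| ≤ |q * x u| := by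
            rw [abs_mul]; exact mul_le_mul_of_nonneg_right (le_abs_self _) (abs_nonneg _)
        _ ≤ ∑ v, |if G.Adj u v then x u + x v else 0| := by
            rw [← h]; exact Finset.abs_sum_le_sum_abs _ _
        _ ≤ _ := by
            refine Finset.sum_le_sum fun v _ => ?_
            split_ifs
            · exact (abs_add_le _ _).trans (add_le_add (hxM u) (hxM v))
            · simp
    have h3 : (∑ v, if G.Adj u v then M * d u + M * d v else 0) = M * (d u * d u + σ) := by
      have : d u * d u = ∑ v, if G.Adj u v then d u else 0 := by
        nth_rewrite 2 [hd]
        simp only [Finset.mul_sum, mul_ite, mul_one, mul_zero]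
      rw [this, hσ, ← Finset.sum_add_distrib, Finset.mul_sum]
      refine Finset.sum_congr rfl fun v _ => ?_
      split_ifs <;> ring
    rw [h3, hxu] at h2
    refine le_of_mul_le_mul_left ?_ hMpos
    linarith
  have h2 : σ ≤ d u * (n - 1) := by
    rw [hσ, hd, Finset.sum_mul]
    refine Finset.sum_le_sum fun v _ => ?_
    split_ifs
    · simpa using hdn v
    · simp
  -- The `n - 1 - d u` non-neighbours of `u` each have degree at least 1.
  have h3 : σ + d u + (n - 1 - d u) ≤ ∑ v, d v := by
    have h4 : σ + d u + (n - 1 - d u) =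
        ∑ v, ((if G.Adj u v then d v else 0) + (if u = v then d u else 0) +
          (1 - (if u = v then 1 else 0) - if G.Adj u v then 1 else 0)) := by
      simp only [Finset.sum_add_distrib, Finset.sum_sub_distrib, Finset.sum_ite_eq,
        Finset.mem_univ, if_true]
      simp [hn, hσ, hd]
    rw [h4]
    refine Finset.sum_le_sum fun v _ => ?_
    by_cases h : u = v
    · subst h; simp
    · simp only [h, if_false]
      split_ifs
      · simp
      · simpa using hd1 v
  -- Key product: `(n - 1 - d u) * (d u * (n - 1) - σ) ≥ 0`.
  have h5 : q * d u * (n - 1) ≤ ((∑ v, d v) + (n - 2) * (n - 1)) * d u := by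
    nlinarith [mul_nonneg (sub_nonneg.2 (hdn u)) (sub_nonneg.2 h2),
      mul_le_mul_of_nonneg_right h3 (hdpos u).le, mul_le_mul_of_nonneg_right h1 (by linarith : 0 ≤ n - 1)]
  have h6 : q * (n - 1) ≤ (∑ v, d v) + (n - 2) * (n - 1) :=
    le_of_mul_le_mul_right (by linarith) (hdpos u)
  have h7 : q ≤ ((∑ v, d v) + (n - 2) * (n - 1)) / (n - 1) :=
    (le_div_iff₀ (by linarith)).2 h6
  rw [add_div, mul_div_cancel_right₀ _ (by linarith : n - 1 ≠ 0)] at h7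
  linarith

end SignlessLaplacian

/-! ### A lower bound for the Q-index of the extremal graph. -/

section ExtremalGraph

theorem extremalGraph_adj_inl_inl {b l n : ℕ} (x y : Fin (b * l - 1)) :
    (extremalGraph b l n).Adj (.inl x) (.inl y) ↔ x ≠ y := by
  simp [extremalGraph, graphJoin]

theorem extremalGraph_adj_inl_inr {b l n : ℕ} (x : Fin (b * l - 1))
    (y : Fin (n + 2 - (b + 1) * l) ⊕ Fin (l - 1)) :
    (extremalGraph b l n).Adj (.inl x) (.inr y) ↔ True := by
  simp [extremalGraph, graphJoin]

theorem extremalGraph_adj_inr_inl {b l n : ℕ} (x : Fin (b * l - 1))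
    (y : Fin (n + 2 - (b + 1) * l) ⊕ Fin (l - 1)) :
    (extremalGraph b l n).Adj (.inr y) (.inl x) ↔ True := by
  simp [extremalGraph, graphJoin]

theorem extremalGraph_adj_inr_inr {b l n : ℕ} (x y : Fin (n + 2 - (b + 1) * l) ⊕ Fin (l - 1)) :
    (extremalGraph b l n).Adj (.inr x) (.inr y) ↔
      ∃ i j, x = .inl i ∧ y = .inl j ∧ i ≠ j := by
  rcases x with x | x <;> rcases y with y | y <;> simp [extremalGraph, graphJoin]

/-- Rayleigh quotient of the indicator of the clique on `n - l + 1` vertices; the edges to the `l -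
1` isolated vertices make the bound strict. -/
theorem lt_qIndex_extremalGraph {b l n : ℕ} (hb : 1 ≤ b) (hl : 2 ≤ l)
    (hn : (b + 1) * l ≤ n + 1) : 2 * (n : ℝ) - 2 * l < qIndex (extremalGraph b l n) := by
  classical
  have hbl : 2 ≤ b * l := hl.trans (Nat.le_mul_of_pos_left l hb)
  have hexp : (b + 1) * l = b * l + l := by ring
  obtain ⟨p, hp⟩ : ∃ p, p = b * l - 1 := ⟨_, rfl⟩
  obtain ⟨r, hr⟩ : ∃ r, r = n + 2 - (b + 1) * l := ⟨_, rfl⟩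
  obtain ⟨t, ht⟩ : ∃ t, t = l - 1 := ⟨_, rfl⟩
  have hsum : (p : ℝ) + r = n + 1 - l := by
    have : p + r + l = n + 1 := by omega
    rw [← Nat.cast_inj (R := ℝ)] at this
    push_cast at this
    linarith
  have hp1 : (1 : ℝ) ≤ p := by exact_mod_cast (by omega : 1 ≤ p)
  have hr1 : (1 : ℝ) ≤ r := by exact_mod_cast (by omega : 1 ≤ r)
  have ht1 : (1 : ℝ) ≤ t := by exact_mod_cast (by omega : 1 ≤ t)
  let x : Fin (b * l - 1) ⊕ (Fin (n + 2 - (b + 1) * l) ⊕ Fin (l - 1)) → ℝ :=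
    Sum.elim (fun _ => 1) (Sum.elim (fun _ => 1) fun _ => 0)
  have hcount : ∀ (m : ℕ) (i : Fin m), (∑ j : Fin m, if i = j then (0 : ℝ) else 1 + 1) =
      2 * m - 2 := by
    intro m i
    have : ∀ j : Fin m, (if i = j then (0 : ℝ) else 1 + 1) = 2 - if i = j then 2 else 0 := by
      intro j; split_ifs <;> norm_num
    simp only [this, Finset.sum_sub_distrib, Finset.sum_ite_eq, Finset.mem_univ, if_true]
    simp [mul_comm]
  have h1 : ∀ i, (signlessLaplacian (extremalGraph b l n)).mulVec x (.inl i) =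
      2 * p - 2 + 2 * r + t := by
    intro i
    rw [signlessLaplacian_mulVec_apply, Fintype.sum_sum_type, Fintype.sum_sum_type]
    simp only [extremalGraph_adj_inl_inl, extremalGraph_adj_inl_inr, x, Sum.elim_inl, Sum.elim_inr,
      ite_not, hcount, if_true, Finset.sum_const, Finset.card_univ, Fintype.card_fin, nsmul_eq_mul,
      ← hp, ← hr, ← ht]
    ring
  have h2 : ∀ i, (signlessLaplacian (extremalGraph b l n)).mulVec x (.inr (.inl i)) =
      2 * p + (2 * r - 2) := by
    intro i
    rw [signlessLaplacian_mulVec_apply, Fintype.sum_sum_type, Fintype.sum_sum_type]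
    simp [extremalGraph_adj_inr_inl, extremalGraph_adj_inr_inr, x, hcount, -Nat.cast_sub,
      -Nat.cast_pred, ← hp, ← hr]
    ring
  have h3 := dotProduct_signlessLaplacian_mulVec_le (extremalGraph b l n) x
  have h4 : x ⬝ᵥ x = p + r := by
    simp only [dotProduct, Fintype.sum_sum_type, x, Sum.elim_inl, Sum.elim_inr, Finset.sum_const,
      Finset.card_univ, Fintype.card_fin, nsmul_eq_mul, ← hp, ← hr]
    ring
  have h5 : x ⬝ᵥ (signlessLaplacian (extremalGraph b l n)).mulVec x =
      p * (2 * p - 2 + 2 * r + t) + r * (2 * p + (2 * r - 2)) := by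
    simp only [dotProduct, Fintype.sum_sum_type, h1, h2]
    simp only [x, Sum.elim_inl, Sum.elim_inr, zero_mul, Finset.sum_const_zero, Finset.sum_const,
      Finset.card_univ, Fintype.card_fin, nsmul_eq_mul, ← hp, ← hr]
    ring
  rw [h4, h5] at h3
  have h6 : 2 * ((p : ℝ) + r - 1) * (p + r) < qIndex (extremalGraph b l n) * (p + r) := by
    nlinarith [mul_pos (by linarith : (0 : ℝ) < p) (by linarith : (0 : ℝ) < t)]
  have h7 := lt_of_mul_lt_mul_right h6 (by linarith)
  rw [hsum] at h7
  linarith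

end ExtremalGraph

/-! ### Components after deletion, toughness and edge counting. -/

section Components

variable {V : Type*}

theorem card_le_numComponentsDelete [Finite V] (G : SimpleGraph V) (S : Finset V) {K : Type*}
    [Finite K] (f : {v | v ∉ S} → K) (hf : ∀ u v, G.Adj u.1 v.1 → f u = f v)
    (hsurj : Function.Surjective f) : Nat.card K ≤ numComponentsDelete G S := by
  have hw : ∀ u v, (G.induce {v | v ∉ S}).Walk u v → f u = f v := by
    intro u v p
    induction p with
    | nil => rfl
    | cons h _ ih => exact (hf _ _ h).trans ih
  refine Nat.card_le_card_of_surjective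
    (SimpleGraph.ConnectedComponent.lift f fun u v p _ => hw u v p) fun k => ?_
  obtain ⟨v, rfl⟩ := hsurj k
  exact ⟨(G.induce {v | v ∉ S}).connectedComponentMk v, rfl⟩

theorem numComponentsDelete_le_indepNum [Finite V] (G : SimpleGraph V) (S : Finset V) :
    numComponentsDelete G S ≤ G.indepNum := by
  classical
  have := Fintype.ofFinite V
  have := Fintype.ofFinite (G.induce {v | v ∉ S}).ConnectedComponent
  choose r hr using fun k : (G.induce {v | v ∉ S}).ConnectedComponent => k.exists_rep
  have hinj : Function.Injective fun k => (r k).1 := by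
    intro k k' h
    rw [← hr k, ← hr k', Subtype.ext h]
  have hI : G.IsIndepSet ((Finset.univ.image fun k => (r k).1 : Finset V) : Set V) := by
    intro u hu v hv huv hadj
    simp only [Finset.coe_image, Finset.coe_univ, Set.image_univ, Set.mem_range] at hu hv
    obtain ⟨k, rfl⟩ := hu
    obtain ⟨k', rfl⟩ := hv
    apply huv
    have : k = k' := by
      rw [← hr k, ← hr k']
      exact SimpleGraph.ConnectedComponent.sound
        (SimpleGraph.Adj.reachable (G := G.induce {v | v ∉ S}) hadj)
    rw [this]
  have := hI.card_le_indepNum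
  rwa [Finset.card_image_of_injective _ hinj, Finset.card_univ, ← Nat.card_eq_fintype_card] at this

/-- The value `⊤` does no harm: one vertex from each component is an independent set, so an
admissible `S` forces `l ≤ α(G)`. -/
theorem lToughness_lt_iff [Fintype V] (G : SimpleGraph V) {b l : ℕ} (hl : 1 ≤ l) :
    lToughness l G < b ↔
      ∃ S : Finset V, l ≤ numComponentsDelete G S ∧ S.card < b * numComponentsDelete G S := by
  have key : ∀ S : Finset V, l ≤ numComponentsDelete G S →
      ((S.card : ℝ≥0∞) / (numComponentsDelete G S : ℝ≥0∞) < b ↔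
        S.card < b * numComponentsDelete G S) := by
    intro S hS
    rw [ENNReal.div_lt_iff (.inl (by simp; omega)) (.inl (ENNReal.natCast_ne_top _))]
    exact_mod_cast Iff.rfl
  unfold lToughness
  split_ifs with h
  · simp only [iInf_lt_iff]
    exact ⟨fun ⟨S, hS, h⟩ => ⟨S, hS, (key S hS).1 h⟩, fun ⟨S, hS, h⟩ => ⟨S, hS, (key S hS).2 h⟩⟩
  · simp only [not_top_lt, false_iff]
    rintro ⟨S, hS, -⟩
    exact h (hS.trans (numComponentsDelete_le_indepNum G S))

theorem lToughness_lt_of_iso [Fintype V] (G : SimpleGraph V) {b l n : ℕ} (hb : 1 ≤ b) (hl : 2 ≤ l)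
    (hn : (b + 1) * l ≤ n + 1) (φ : G ≃g extremalGraph b l n) : lToughness l G < b := by
  classical
  rw [lToughness_lt_iff G (by omega)]
  let S : Finset V := Finset.univ.map
    ⟨fun i : Fin (b * l - 1) => φ.symm (.inl i), φ.symm.injective.comp Sum.inl_injective⟩
  have hmem : ∀ v, v ∉ S ↔ ∃ y, φ v = .inr y := by
    intro v
    rcases h : φ v with i | y
    · have hv : φ.symm (.inl i) = v := by rw [← h, φ.symm_apply_apply]
      simp only [S, Finset.mem_map, Finset.mem_univ, true_and, Function.Embedding.coeFn_mk]
      exact ⟨fun hn => (hn ⟨i, hv⟩).elim, by rintro ⟨y, hy⟩; cases hy⟩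
    · have : ∀ i, φ.symm (.inl i) ≠ v := by
        rintro i rfl
        simp at h
      simp [S, this]
  have hS : S.card = b * l - 1 := by simp [S]
  -- `none` labels the clique component, nonempty because `(b + 1) * l ≤ n + 1`.
  let f : {v | v ∉ S} → Option (Fin (l - 1)) := fun v =>
    Sum.elim (fun _ => none) (Sum.elim (fun _ => none) some) (φ v.1)
  have hc : l ≤ numComponentsDelete G S := by
    have := card_le_numComponentsDelete G S f (fun u v huv => by
      obtain ⟨y, hy⟩ := (hmem u.1).1 u.2
      obtain ⟨z, hz⟩ := (hmem v.1).1 v.2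
      rw [← φ.map_adj_iff, hy, hz, extremalGraph_adj_inr_inr] at huv
      obtain ⟨i, j, rfl, rfl, -⟩ := huv
      simp [f, hy, hz]) (fun k => by
      rcases k with _ | i
      · exact ⟨⟨φ.symm (.inr (.inl ⟨0, by omega⟩)), (hmem _).2 ⟨_, φ.apply_symm_apply _⟩⟩, by simp [f]⟩
      · exact ⟨⟨φ.symm (.inr (.inr i)), (hmem _).2 ⟨_, φ.apply_symm_apply _⟩⟩, by simp [f]⟩)
    rw [Nat.card_eq_fintype_card, Fintype.card_option, Fintype.card_fin] at this
    omega
  refine ⟨S, hc, ?_⟩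
  have h1 : b * l ≤ b * numComponentsDelete G S := Nat.mul_le_mul_left b hc
  have h2 : 2 ≤ b * l := hl.trans (Nat.le_mul_of_pos_left l hb)
  omega

open Classical in
/-- If every edge between vertices labelled by `some` joins vertices with equal labels, the number
of ordered pairs of adjacent vertices is bounded in terms of the label class sizes. -/
theorem sum_adj_add_le_of_label [Fintype V] (G : SimpleGraph V) {K : Type*} [Fintype K]
    (κ : V → Option K) (hκ : ∀ u v i j, G.Adj u v → κ u = some i → κ v = some j → i = j) :
    (∑ u, ∑ v, if G.Adj u v then (1 : ℝ) else 0) + Fintype.card V +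
      (∑ k, ((Finset.univ.filter fun v => κ v = some k).card : ℝ)) ^ 2 ≤
    (Fintype.card V : ℝ) ^ 2 +
      ∑ k, ((Finset.univ.filter fun v => κ v = some k).card : ℝ) ^ 2 := by
  let e : K → V → ℝ := fun k v => if κ v = some k then 1 else 0
  have he : ∀ k, ((Finset.univ.filter fun v => κ v = some k).card : ℝ) = ∑ v, e k v := by
    intro k; simp [e]
  have h1 : (∑ k, ∑ v, e k v) ^ 2 = ∑ u, ∑ v, (∑ k, e k u) * ∑ k, e k v := by
    rw [Finset.sum_comm, sq, Finset.sum_mul_sum]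
  have h2 : ∑ k, (∑ v, e k v) ^ 2 = ∑ u, ∑ v, ∑ k, e k u * e k v := by
    simp_rw [sq, Finset.sum_mul_sum]
    rw [Finset.sum_comm]
    exact Finset.sum_congr rfl fun u _ => Finset.sum_comm
  have h3 : (Fintype.card V : ℝ) = ∑ u : V, ∑ v : V, if u = v then (1 : ℝ) else 0 := by simp
  have h4 : (Fintype.card V : ℝ) ^ 2 = ∑ u : V, ∑ v : V, (1 : ℝ) := by simp [sq]
  simp_rw [he]
  rw [h1, h2, h4]
  nth_rewrite 1 [h3]
  simp_rw [← Finset.sum_add_distrib]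
  -- Pair by pair: `[u ~ v] + [u = v] + [both labelled] ≤ 1 + [same label]`.
  refine Finset.sum_le_sum fun u _ => Finset.sum_le_sum fun v _ => ?_
  rcases hu : κ u with _ | i
  · by_cases huv : u = v
    · subst huv; simp [e, hu]
    · simp [e, hu, huv]; split_ifs <;> norm_num
  rcases hv : κ v with _ | j
  · have huv : u ≠ v := by rintro rfl; simp [hu] at hv
    simp [e, hv, huv]; split_ifs <;> norm_num
  by_cases hij : i = j
  · subst hij
    by_cases huv : u = v
    · subst huv; simp [e, hu]
    · simp only [e, hu, hv, huv, if_false]; split_ifs <;> simp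
  · have huv : u ≠ v := by rintro rfl; simp [hu] at hv; exact hij hv
    have hadj : ¬ G.Adj u v := fun h => hij (hκ u v i j h hu hv)
    simp [e, hu, hv, huv, hadj, hij]

/-- A graph whose non-`S` vertices are labelled by `l` classes, all but one of which are
singletons, with no edges between classes, is a spanning subgraph of the extremal graph. -/
theorem exists_equiv_extremalGraph_of_label [Fintype V] (G : SimpleGraph V) {b l n : ℕ}
    (hb : 1 ≤ b) (hl : 2 ≤ l) (hV : Fintype.card V = n) (hn : (b + 1) * l ≤ n + 1)
    {K : Type*} [Fintype K] [DecidableEq K] (hK : Fintype.card K = l) (κ : V → Option K)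
    (hκ : ∀ u v i j, G.Adj u v → κ u = some i → κ v = some j → i = j)
    (hS : (Finset.univ.filter fun v => κ v = none).card ≤ b * l - 1) (k₀ : K)
    (h1 : ∀ k ≠ k₀, (Finset.univ.filter fun v => κ v = some k).card = 1) :
    ∃ g : (Fin (b * l - 1) ⊕ (Fin (n + 2 - (b + 1) * l) ⊕ Fin (l - 1))) ≃ V,
      ∀ x y, G.Adj (g x) (g y) → (extremalGraph b l n).Adj x y := by
  classical
  have hbl : 2 ≤ b * l := hl.trans (Nat.le_mul_of_pos_left l hb)
  have hexp : (b + 1) * l = b * l + l := by ring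
  set S := Finset.univ.filter fun v => κ v = none with hSdef
  set T : Finset V := (Finset.univ.erase k₀).biUnion fun k =>
    Finset.univ.filter fun v => κ v = some k with hTdef
  have hT : T.card = l - 1 := by
    rw [hTdef, Finset.card_biUnion, Finset.sum_congr rfl (g := fun _ => 1)]
    · simp [hK]
    · intro k hk
      exact h1 k (Finset.ne_of_mem_erase hk)
    · intro i _ j _ hij
      refine Finset.disjoint_filter.2 fun v _ hi hj => hij ?_
      rw [hi] at hj
      exact Option.some_injective _ hj
  have hTmem : ∀ v, v ∈ T ↔ ∃ k, k ≠ k₀ ∧ κ v = some k := by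
    intro v; simp [hTdef]
  have hST : S ⊆ Tᶜ := by
    intro v hv
    rw [Finset.mem_compl, hTmem]
    rintro ⟨k, -, hk⟩
    simp [hSdef, hk] at hv
  -- `S` may be too small; it is filled up to `bl - 1` with vertices of the class `k₀`.
  obtain ⟨S', hSS', hS'T, hS'⟩ := Finset.exists_subsuperset_card_eq hST hS
    (by rw [Finset.card_compl, hT, hV]; omega)
  set R := (S' ∪ T)ᶜ with hRdef
  have hdisj : Disjoint S' T := Finset.disjoint_left.2 fun v hv => Finset.mem_compl.1 (hS'T hv)
  have hR : R.card = n + 2 - (b + 1) * l := by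
    rw [hRdef, Finset.card_compl, Finset.card_union_of_disjoint hdisj, hT, hS', hV]; omega
  let f₁ := (S'.equivFinOfCardEq hS').symm
  let f₂ := (R.equivFinOfCardEq hR).symm
  let f₃ := (T.equivFinOfCardEq hT).symm
  let g : (Fin (b * l - 1) ⊕ (Fin (n + 2 - (b + 1) * l) ⊕ Fin (l - 1))) → V :=
    Sum.elim (fun i => (f₁ i).1) (Sum.elim (fun i => (f₂ i).1) fun i => (f₃ i).1)
  have hR' : ∀ i, (f₂ i).1 ∉ S' ∧ (f₂ i).1 ∉ T := by
    intro i
    have := (f₂ i).2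
    simpa [hRdef] using this
  have hginj : Function.Injective g := by
    refine (Subtype.val_injective.comp f₁.injective).sumElim
      ((Subtype.val_injective.comp f₂.injective).sumElim
        (Subtype.val_injective.comp f₃.injective) ?_) ?_
    · intro i j h
      exact (hR' i).2 (by rw [show (f₂ i).1 = (f₃ j).1 from h]; exact (f₃ j).2)
    · rintro i (j | j) h
      · exact (hR' j).1 (by rw [← show (f₁ i).1 = (f₂ j).1 from h]; exact (f₁ i).2)
      · exact Finset.disjoint_left.1 hdisj (f₁ i).2
          (by rw [show (f₁ i).1 = (f₃ j).1 from h]; exact (f₃ j).2)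
  have hgbij : Function.Bijective g := (Fintype.bijective_iff_injective_and_card g).2
    ⟨hginj, by simp only [Fintype.card_sum, Fintype.card_fin, hV]; omega⟩
  have hlabel : ∀ u v, G.Adj u v → u ∈ T → v ∉ S' → False := by
    intro u v huv hu hv
    obtain ⟨k, hk, hku⟩ := (hTmem u).1 hu
    rcases hkv : κ v with _ | j
    · exact hv (hSS' (by simp [hSdef, hkv]))
    · obtain rfl := hκ u v k j huv hku hkv
      obtain ⟨w, hw⟩ := Finset.card_eq_one.1 (h1 k hk)
      have hu' : u ∈ ({w} : Finset V) := hw ▸ by simp [hku]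
      have hv' : v ∈ ({w} : Finset V) := hw ▸ by simp [hkv]
      rw [Finset.mem_singleton] at hu' hv'
      exact huv.ne (hu'.trans hv'.symm)
  have hT' : ∀ i, (f₃ i).1 ∉ S' := fun i => Finset.disjoint_right.1 hdisj (f₃ i).2
  refine ⟨Equiv.ofBijective g hgbij, ?_⟩
  intro x y hxy
  simp only [Equiv.ofBijective_apply] at hxy
  rcases x with x | x | x <;> rcases y with y | y | y
  · rw [extremalGraph_adj_inl_inl]; rintro rfl; exact hxy.ne rfl
  · exact (extremalGraph_adj_inl_inr _ _).2 trivial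
  · exact (extremalGraph_adj_inl_inr _ _).2 trivial
  · exact (extremalGraph_adj_inr_inl _ _).2 trivial
  · exact (extremalGraph_adj_inr_inr _ _).2 ⟨x, y, rfl, rfl, by rintro rfl; exact hxy.ne rfl⟩
  · exact (hlabel _ _ hxy.symm (f₃ y).2 (hR' x).1).elim
  · exact (extremalGraph_adj_inr_inl _ _).2 trivial
  · exact (hlabel _ _ hxy (f₃ x).2 (hR' y).1).elim
  · exact (hlabel _ _ hxy (f₃ x).2 (hT' y)).elim

end Components

/-! ### Convexity bounds for sums of squares. -/

section SumSq

variable {K : Type*} [Fintype K]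

theorem sum_sq_le_of_one_le (m : K → ℝ) (hm : ∀ k, 1 ≤ m k) :
    ∑ k, m k ^ 2 ≤ (∑ k, m k - Fintype.card K) ^ 2 + 2 * (∑ k, m k) - Fintype.card K := by
  have h : ∑ k, (m k - 1) ^ 2 ≤ (∑ k, (m k - 1)) ^ 2 :=
    Finset.sum_sq_le_sq_sum_of_nonneg fun k _ => sub_nonneg.2 (hm k)
  have e : ∑ k, (m k - 1) ^ 2 = ∑ k, m k ^ 2 - 2 * ∑ k, m k + Fintype.card K := by
    simp [sub_sq, Finset.sum_add_distrib, Finset.sum_sub_distrib, Finset.mul_sum]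
  simp only [Finset.sum_sub_distrib, Finset.sum_const, Finset.card_univ, nsmul_eq_mul, mul_one] at h
  linarith

/-- With `A = m i - 1` and `B` the sum of the other `m k - 1`, both at least 1, `A² + B² ≤ (A + B -
1)² + 1` because `(A - 1)(B - 1) ≥ 0`. -/
theorem sum_sq_le_of_two_le (m : K → ℝ) (hm : ∀ k, 1 ≤ m k) {i j : K} (hij : i ≠ j)
    (hi : 2 ≤ m i) (hj : 2 ≤ m j) :
    ∑ k, m k ^ 2 ≤
      (∑ k, m k - Fintype.card K - 1) ^ 2 + 1 + 2 * (∑ k, m k) - Fintype.card K := by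
  classical
  have e : ∑ k, (m k - 1) ^ 2 = ∑ k, m k ^ 2 - 2 * ∑ k, m k + Fintype.card K := by
    simp [sub_sq, Finset.sum_add_distrib, Finset.sum_sub_distrib, Finset.mul_sum]
  have e' : ∑ k, (m k - 1) = ∑ k, m k - Fintype.card K := by
    simp [Finset.sum_sub_distrib]
  have h : ∑ k ∈ Finset.univ.erase i, (m k - 1) ^ 2 ≤
      (∑ k ∈ Finset.univ.erase i, (m k - 1)) ^ 2 :=
    Finset.sum_sq_le_sq_sum_of_nonneg fun k _ => sub_nonneg.2 (hm k)
  have h1 : m j - 1 ≤ ∑ k ∈ Finset.univ.erase i, (m k - 1) :=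
    Finset.single_le_sum (f := fun k => m k - 1) (fun k _ => sub_nonneg.2 (hm k))
      (Finset.mem_erase.2 ⟨hij.symm, Finset.mem_univ j⟩)
  have h2 := Finset.add_sum_erase Finset.univ (fun k => m k - 1) (Finset.mem_univ i)
  have h3 := Finset.add_sum_erase Finset.univ (fun k => (m k - 1) ^ 2) (Finset.mem_univ i)
  nlinarith [mul_nonneg (by linarith : 0 ≤ m i - 1 - 1)
    (by linarith : 0 ≤ ∑ k ∈ Finset.univ.erase i, (m k - 1) - 1)]

end SumSq

/-! ### The numerical inequality for more than `l` components. -/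

theorem two_mul_le_of_order_bound {n b l s c : ℝ} (hb : 1 ≤ b) (hl : 2 ≤ l)
    (hn1 : (5 / 2 * b ^ 2 + 4 * b + 3) * l - b ^ 2 - 2 * b - 5 ≤ n)
    (hn2 : ((2 * b + 1) * l ^ 2 + (2 * b - 3) * l + 2) / 2 ≤ n)
    (hc : l + 1 ≤ c) (hsc : s + c ≤ n) (hs : s ≤ b * c - 1) (hcn : 1 ≤ n) :
    2 * (l - 1) * (n - 1) ≤ (c - 1) * (2 * n - 2 * s - c) := by
  have hb2 : 0 < (b + 1) ^ 2 := by positivity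
  have h1 : 2 * (l - 1) * (b + 1) ^ 2 ≤ n - b := by nlinarith [mul_nonneg (sq_nonneg b) (by linarith : 0 ≤ l - 2)]
  have hnb : 0 ≤ n - b := le_trans (by nlinarith) h1
  have hF : 2 * (l - 1) * (n - 1) * (b + 1) ^ 2 ≤ (n + 1) * (n - b) := by
    nlinarith [mul_le_mul_of_nonneg_right h1 (by linarith : 0 ≤ n - 1)]
  have hT : ∀ T, n + 1 ≤ (b + 1) * T → 2 * (l - 1) * (n - 1) ≤ (T - 1) * T := by
    intro T hT
    have h3 : (n + 1) * (n - b) ≤ ((b + 1) * T) * ((b + 1) * (T - 1)) :=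
      mul_le_mul hT (by linarith) hnb (by linarith)
    exact le_of_mul_le_mul_right (by linarith) hb2
  -- The threshold decides which bound on `s` is stronger: `n - c` or `bc - 1`.
  rcases le_total (n + 1) ((b + 1) * c) with h | h
  · exact (hT c h).trans (mul_le_mul_of_nonneg_left (by linarith) (by linarith))
  · have hs' : (c - 1) * (2 * n + 2 - (2 * b + 1) * c) ≤ (c - 1) * (2 * n - 2 * s - c) :=
      mul_le_mul_of_nonneg_left (by linarith) (by linarith)
    refine le_trans ?_ hs'
    -- The bound is now a concave quadratic in `c`, minimal at an end of `[l + 1, (n + 1)/(b + 1)]`.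
    -- At `l + 1` the claim is exactly `hn2`; the other end follows from `hn1` through `hT`.
    by_cases h4 : (2 * b + 1) * (c + l + 1) ≤ 2 * n + 3 + 2 * b
    · have : 0 ≤ (c - (l + 1)) * (2 * n + 3 + 2 * b - (2 * b + 1) * (c + l + 1)) :=
        mul_nonneg (by linarith) (by linarith)
      nlinarith
    · obtain ⟨T, hTe⟩ : ∃ T, (b + 1) * T = n + 1 :=
        ⟨(n + 1) / (b + 1), mul_div_cancel₀ _ (by linarith : b + 1 ≠ 0)⟩
      have hcT : c ≤ T := le_of_mul_le_mul_left (h.trans hTe.ge) (by linarith)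
      have h5 := hT T hTe.ge
      have h6 : 0 ≤ (T - c) * ((2 * b + 1) * (c + T) - (2 * n + 3 + 2 * b)) := by
        refine mul_nonneg (by linarith) ?_
        have : (2 * b + 1) * (c + l + 1) ≤ (2 * b + 1) * (c + T) :=
          mul_le_mul_of_nonneg_left (by linarith) (by linarith)
        linarith
      have h7 : (T - 1) * T = (T - 1) * (2 * n + 2 - (2 * b + 1) * T) := by
        linear_combination 2 * (T - 1) * hTe
      nlinarith

/-! ### The main theorem. -/

theorem theorem1p1 (b l n : ℕ) (hb : 1 ≤ b) (hl : 2 ≤ l)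
    {V : Type*} [Fintype V] (G : SimpleGraph V) (hG : G.Connected) (hV : Fintype.card V = n)
    (hn : max ((5 / 2 * (b : ℝ) ^ 2 + 4 * (b : ℝ) + 3) * (l : ℝ) - (b : ℝ) ^ 2 - 2 * (b : ℝ) - 5)
        (((2 * (b : ℝ) + 1) * (l : ℝ) ^ 2 + (2 * (b : ℝ) - 3) * (l : ℝ) + 2) / 2) ≤ (n : ℝ))
    (hq : qIndex (extremalGraph b l n) ≤ qIndex G) :
    (¬ Nonempty (G ≃g extremalGraph b l n) → (b : ℝ≥0∞) ≤ lToughness l G) ∧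
      (Nonempty (G ≃g extremalGraph b l n) → lToughness l G < (b : ℝ≥0∞)) := by
  classical
  obtain ⟨hn1, hn2⟩ := max_le_iff.1 hn
  have hbR : (1 : ℝ) ≤ b := by exact_mod_cast hb
  have hlR : (2 : ℝ) ≤ l := by exact_mod_cast hl
  have hnbl : (b + 1) * l ≤ n + 1 := by
    have : ((b : ℝ) + 1) * l ≤ n + 1 := by
      nlinarith [mul_nonneg (sq_nonneg (b : ℝ)) (by linarith : (0 : ℝ) ≤ l - 2)]
    exact_mod_cast this
  refine ⟨fun hne => ?_, fun ⟨φ⟩ => lToughness_lt_of_iso G hb hl hnbl φ⟩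
  by_contra! hlt
  obtain ⟨S, hlS, hSb⟩ := (lToughness_lt_iff G (by omega)).1 hlt
  have hqH := (lt_qIndex_extremalGraph hb hl hnbl).trans_le hq
  have hn2' : 2 ≤ n := by nlinarith
  have hn2R : (2 : ℝ) ≤ n := by exact_mod_cast hn2'
  have hFY := qIndex_le_of_connected G hG (hV.symm ▸ hn2')
  rw [hV] at hFY
  set D : ℝ := ∑ u, ∑ v, if G.Adj u v then (1 : ℝ) else 0 with hD
  -- The spectral hypothesis enters the edge counts only through this bound.
  have hDgt : ¬ D ≤ ((n : ℝ) - 1) * (n - 2 * l + 2) := by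
    intro h
    have : D / ((n : ℝ) - 1) ≤ n - 2 * l + 2 :=
      (div_le_iff₀ (by linarith)).2 (by linarith)
    linarith
  let K := (G.induce {v | v ∉ S}).ConnectedComponent
  have : Fintype K := Fintype.ofFinite K
  set c := numComponentsDelete G S with hcdef
  have hcK : Fintype.card K = c := by rw [hcdef, numComponentsDelete, Nat.card_eq_fintype_card]
  let κ : V → Option K := fun v =>
    if h : v ∉ S then some ((G.induce {v | v ∉ S}).connectedComponentMk ⟨v, h⟩) else none
  have hκ_none : ∀ v, κ v = none ↔ v ∈ S := by intro v; simp [κ]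
  have hκ : ∀ u v i j, G.Adj u v → κ u = some i → κ v = some j → i = j := by
    intro u v i j huv hi hj
    have hu : u ∉ S := fun h => by simp [(hκ_none u).2 h] at hi
    have hv : v ∉ S := fun h => by simp [(hκ_none v).2 h] at hj
    simp only [κ, hu, hv, not_false_eq_true, dif_pos, Option.some.injEq] at hi hj
    rw [← hi, ← hj]
    exact SimpleGraph.ConnectedComponent.sound
      (SimpleGraph.Adj.reachable (G := G.induce {v | v ∉ S}) huv)
  obtain ⟨m, hm⟩ : ∃ m : K → ℕ, ∀ k, m k = (Finset.univ.filter fun v => κ v = some k).card :=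
    ⟨_, fun _ => rfl⟩
  have hm1 : ∀ k, 1 ≤ m k := by
    intro k
    obtain ⟨⟨v, hv⟩, rfl⟩ := k.exists_rep
    refine (hm _).symm ▸ Finset.card_pos.2 ⟨v, Finset.mem_filter.2 ⟨Finset.mem_univ v, dif_pos hv⟩⟩
  have hm1R : ∀ k, (1 : ℝ) ≤ m k := fun k => by exact_mod_cast hm1 k
  have hSnone : (Finset.univ.filter fun v => κ v = none) = S := by
    ext v; simp [hκ_none]
  have hsum : S.card + ∑ k, m k = n := by
    rw [← hV, ← Finset.card_univ (α := V),
      Finset.card_eq_sum_card_fiberwise (s := Finset.univ) (f := κ) (t := Finset.univ) (by simp),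
      Fintype.sum_option, hSnone]
    simp only [hm]
  have hsumR : (S.card : ℝ) + ∑ k, (m k : ℝ) = n := by exact_mod_cast hsum
  have hcount := sum_adj_add_le_of_label G κ hκ
  simp_rw [← hm] at hcount
  rw [← hD, hV] at hcount
  have hcm : (c : ℝ) ≤ ∑ k, (m k : ℝ) := by
    calc (c : ℝ) = ∑ _k : K, (1 : ℝ) := by simp [hcK]
      _ ≤ _ := Finset.sum_le_sum fun k _ => hm1R k
  have hSbR : (S.card : ℝ) ≤ b * c - 1 := by
    have : S.card + 1 ≤ b * c := hSb
    have : (S.card : ℝ) + 1 ≤ b * c := by exact_mod_cast this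
    linarith
  set M : ℝ := ∑ k, (m k : ℝ) with hM
  rcases hlS.lt_or_eq with hlc | hlc
  · have hlcR : (l : ℝ) + 1 ≤ c := by exact_mod_cast hlc
    have h1 := sum_sq_le_of_one_le (fun k => (m k : ℝ)) hm1R
    rw [hcK, ← hM] at h1
    have h2 := two_mul_le_of_order_bound hbR hlR hn1 hn2 hlcR (s := S.card) (by linarith) hSbR
      (by linarith)
    rw [← hsumR] at h2 hcount hDgt
    exact hDgt (by linarith)
  · by_cases htwo : ∃ i j, i ≠ j ∧ 2 ≤ m i ∧ 2 ≤ m j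
    · obtain ⟨i, j, hij, hi, hj⟩ := htwo
      have h1 := sum_sq_le_of_two_le (fun k => (m k : ℝ)) hm1R hij (by exact_mod_cast hi)
        (by exact_mod_cast hj)
      rw [hcK, ← hM, ← hlc] at h1
      rw [← hlc] at hSbR hcm
      have h2 : 0 ≤ ((b : ℝ) * l - 1 - S.card) * l := mul_nonneg (by linarith) (by linarith)
      have h3 : 0 ≤ ((b : ℝ) - 1) * l := mul_nonneg (by linarith) (by linarith)
      have hMe : M = n - S.card := by linarith
      rw [hMe] at h1 hcount
      exact hDgt (by nlinarith)
    · have hlK : 0 < Fintype.card K := by omega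
      obtain ⟨k₁⟩ := Fintype.card_pos_iff.1 hlK
      -- If all components are singletons, any one can serve as `k₀`.
      obtain ⟨k₀, hk₀⟩ : ∃ k₀, ∀ k ≠ k₀, m k = 1 := by
        by_cases h : ∃ k₀, 2 ≤ m k₀
        · obtain ⟨k₀, hk₀⟩ := h
          refine ⟨k₀, fun k hk => ?_⟩
          by_contra hne1
          exact htwo ⟨k, k₀, hk, by have := hm1 k; omega, hk₀⟩
        · push Not at h
          exact ⟨k₁, fun k _ => by have := hm1 k; have := h k; omega⟩
      obtain ⟨g, hg⟩ := exists_equiv_extremalGraph_of_label G hb hl hV hnbl (hcK.trans hlc.symm)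
        κ hκ (by rw [hSnone]; rw [← hlc] at hSb; omega) k₀ (fun k hk => by rw [← hm, hk₀ k hk])
      exact absurd (qIndex_lt_of_equiv G _ hG g hg hne) hq.not_gt
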